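/- **Objects.** For integers $1\le k\le n$ let $\mathcal{DU}_{n,k}$ be the set of permutations $\sigma=\sigma_1\sigma_2\cdots\sigma_n$ of $[n]=\{1,\dots,n\}$ with $\sigma_1>\sigma_2<\sigma_3>\sigma_4<\cdots$ and $\sigma_1=k$. An increasing 1-2 tree on a finite set $V\subset\mathbb N$ is a rooted tree with vertex set $V$ in which every vertex has at most two children and labels increase along every path away from the root. An only child is called a left child; of two siblings the smaller is the left and the larger the right child. The minimal path starts at the root and follows left children to a leaf, called the minimal leaf. Let $\mathcal T_{n,k}$ be the set of increasing 1-2 trees on $[n]$ with minimal leaf $k$. **Algorithm B (the map $\psi$).** For $n=1,2$, $\psi(\pi)$ is the unique increasing 1-2 tree on $[n]$. Let $n\ge 3$ and $\pi\in\mathcal{DU}_{n,k}$. * (B1) If $\pi_2=k-1$, delete $\pi_1=k$ and $\pi_2=k-1$ from $\pi$ and relabel the remaining word by $[n-2]$, preserving the order, to get $\pi'$. Relabel $\psi(\pi')$ by $[n]\setminus\{k-1,k\}$, preserving the order, to get $T''$. Let $m$ be the smallest vertex greater than $k$ in the minimal path of $T''$. Insert a vertex $k-1$ in the middle of the edge from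 the parent of $m$ to $m$ (if $m$ is the root, $k-1$ becomes the new root with child $m$), and graft $k$ as the left child of $k-1$. The result is $\psi(\pi)$. * (B2) If $\pi_2<k-1$, let $\pi'\in\mathcal{DU}_{n,k-1}$ be obtained by exchanging the letters $k-1$ and $k$ in $\pi$, and let $T'=\psi(\pi')$. (a) If $k-1$ and $k$ are not siblings in $T'$, then $\psi(\pi)$ is $T'$ with the labels $k-1$ and $k$ exchanged. (b) If $k-1$ and $k$ are siblings in $T'$, with parent $\ell$, let $A$ and $B$ be the (possibly empty) left and right subtrees of $k$. Then $\psi(\pi)$ is obtained from $T'$ by giving $\ell$ the left child $k-1$ and the right subtree $A$, and giving $k-1$ the leaf $k$ as left child and $B$ as right subtree. **Algorithm C (the map $\psi'$).** Let $\sigma\in\mathcal{DU}_{n,k}$ and $m=\lfloor (n+1)/2\rfloor$. If $n$ is odd, $T^{(m)}$ is the single vertex $\sigma_n$; if $n$ is even, $T^{(m)}$ is the root $\sigma_n$ with left child $\sigma_{n-1}$. For $i=m-1,\dots,1$, let $a$ be the smallest vertex greater than $\sigma_{2i}$ in the minimal path of $T^{(i+1)}$. * (C1) If $a<\sigma_{2i-1}$,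 follow right children from $a$ and let $a=v_1<v_2<\cdots<v_j=b$ be the vertices less than $\sigma_{2i-1}$ on this path. Let $S_1,\dots,S_j$ be the left subtrees of $v_1,\dots,v_j$ and $S_{j+1}$ the right subtree of $v_j$ (possibly empty). In $T^{(i+1)}$ replace the subtree rooted at $a$ by the tree with root $\sigma_{2i}$ whose path of left edges is $\sigma_{2i},v_1,v_2,\dots,v_j,\sigma_{2i-1}$, where $\sigma_{2i},v_1,\dots,v_j$ have right subtrees $S_1,S_2,\dots,S_{j+1}$ respectively and $\sigma_{2i-1}$ is a leaf. * (C2) If $\sigma_{2i-1}<a$, replace the subtree $S$ rooted at $a$ by the tree with root $\sigma_{2i}$, the leaf $\sigma_{2i-1}$ as left child, and $S$ as right subtree. The result is $T^{(i)}$, and $\psi'(\sigma)=T^{(1)}$. **Theorem.** For all $1\le k\le n$, both $\psi$ and $\psi'$ are bijections from $\mathcal{DU}_{n,k}$ to $\mathcal T_{n,k}$, and they are equal: $\psi(\sigma)=\psi'(\sigma)$ for every $\sigma\in\mathcal{DU}_{n,k}$. -/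

import Mathlib

namespace Entringer

/-! ### Alternating permutations

A permutation of `[n] = {1, …, n}` is written as the word `σ₁ σ₂ … σₙ`, a list of natural numbers. -/

/-- `σ₁ > σ₂ < σ₃ > σ₄ < ⋯` (positions in the list are counted from `0`). -/
def IsDownUp (σ : List ℕ) : Prop :=
  ∀ (i : ℕ) (h : i + 1 < σ.length),
    (Even i → σ[i + 1] < σ[i]) ∧ (Odd i → σ[i] < σ[i + 1])

/-- `DU_n`: the (down-up) alternating permutations of `[n]`. -/
def DU (n : ℕ) : Set (List ℕ) :=
  {σ | σ.Perm (List.range' 1 n) ∧ IsDownUp σ}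

/-- `DU_{n,k}`: the alternating permutations of `[n]` with first entry `k`. -/
def DUFirst (n k : ℕ) : Set (List ℕ) :=
  {σ | σ ∈ DU n ∧ σ.head? = some k}

/-! ### Increasing 1-2 trees

An increasing 1-2 tree is a rooted tree with distinct vertex labels, at most two children at every
vertex, and labels increasing along every path from the root.  It is drawn as a binary tree by the
convention that an only child is a left child, and that of two siblings the smaller one is the left
child.  Each increasing 1-2 tree has exactly one such drawing, and this is how it is represented;
`nil` is the empty (sub)tree. -/

open BinaryTree

/-- The list of all vertex labels of a tree. -/
def labels : BinaryTree ℕ → List ℕ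
  | nil => []
  | node v l r => v :: (labels l ++ labels r)

/-- The label of the root, if the tree is not empty. -/
def root? : BinaryTree ℕ → Option ℕ
  | nil => none
  | node v _ _ => some v

/-- The tree with a single vertex. -/
def leaf (v : ℕ) : BinaryTree ℕ := node v nil nil

/-- The conditions on a binary tree to be the drawing of an increasing 1-2 tree (or empty):
labels increase away from the root, and a right child has a smaller left sibling. -/
def IsIncreasing : BinaryTree ℕ → Prop
  | nil => True
  | node v l r =>
      (∀ x ∈ labels l, v < x) ∧ (∀ x ∈ labels r, v < x) ∧
      (∀ y, root? r = some y → ∃ x, root? l = some x ∧ x < y) ∧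
      IsIncreasing l ∧ IsIncreasing r

/-- `T_n`: the increasing 1-2 trees on `[n]`. -/
def Trees (n : ℕ) : Set (BinaryTree ℕ) :=
  {t | (labels t).Perm (List.range' 1 n) ∧ IsIncreasing t}

/-- The minimal path: start at the root and go to the left child until there is none. -/
def minPath : BinaryTree ℕ → List ℕ
  | nil => []
  | node v l _ => v :: minPath l

/-- The minimal leaf: the last vertex of the minimal path. -/
def minLeaf? (t : BinaryTree ℕ) : Option ℕ := (minPath t).getLast?

/-- `T_{n,k}`: the increasing 1-2 trees on `[n]` with minimal leaf `k`. -/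
def TreesLeaf (n k : ℕ) : Set (BinaryTree ℕ) :=
  {t | t ∈ Trees n ∧ minLeaf? t = some k}

/-- Go up the minimal path to its first vertex with a label greater than `c` and replace the whole
subtree `S` rooted at that vertex by `f S`.  Since labels increase along the minimal path, that
vertex is the smallest one greater than `c` in the minimal path. -/
def modifyMinPath (c : ℕ) (f : BinaryTree ℕ → BinaryTree ℕ) : BinaryTree ℕ → BinaryTree ℕ
  | nil => nil
  | node v l r => if c < v then f (node v l r) else node v (modifyMinPath c f l) r

/-! ### Algorithm B: the recursive map `ψ` -/

/-- The relabelling of `[n] ∖ {k-1, k}` by `[n-2]`. -/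
def relabelDown (k x : ℕ) : ℕ := if x < k - 1 then x else x - 2

/-- The relabelling of `[n-2]` by `[n] ∖ {k-1, k}`. -/
def relabelUp (k x : ℕ) : ℕ := if x < k - 1 then x else x + 2

/-- With `m` the smallest vertex greater than `k` in the minimal path, insert `k-1` in the middle of
the edge from the parent of `m` to `m` (as the new root if `m` is the root), and graft `k`
as the left child of `k-1`; thus `m` becomes the right child of `k-1`. -/
def insertB (k : ℕ) (t : BinaryTree ℕ) : BinaryTree ℕ :=
  modifyMinPath k (fun S => node (k - 1) (leaf k) S) t

/-- `x` is the left child and `y` is the right child of one vertex of the tree. -/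
def AreSiblings (x y : ℕ) : BinaryTree ℕ → Prop
  | nil => False
  | node _ l r =>
      (root? l = some x ∧ root? r = some y) ∨ AreSiblings x y l ∨ AreSiblings x y r

instance decidableAreSiblings (x y : ℕ) : ∀ t, Decidable (AreSiblings x y t)
  | nil => isFalse (fun h => h)
  | node _ l r =>
      haveI := decidableAreSiblings x y l
      haveI := decidableAreSiblings x y r
      inferInstanceAs (Decidable
        ((root? l = some x ∧ root? r = some y) ∨ AreSiblings x y l ∨ AreSiblings x y r))

/-- At the vertex `ℓ` whose left child is the leaf `k-1` and whose right child is `k`, where `k` has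
left subtree `A` and right subtree `B`: make `k` a leaf and the left child of `k-1`, make `B` the
right subtree of `k-1`, and make `A` the right subtree of `ℓ`. -/
def siblingMove (k : ℕ) : BinaryTree ℕ → BinaryTree ℕ
  | nil => nil
  | node v l r =>
      if root? l = some (k - 1) ∧ root? r = some k then
        node v (node (k - 1) (leaf k) r.right) r.left
      else node v (siblingMove k l) (siblingMove k r)

/-- The map `ψ`.  The branches for the empty word and for `π₂ ≥ π₁` are never used on an alternating
permutation of `[n]` with `n ≥ 1`. -/
def psi : List ℕ → BinaryTree ℕ
  | [] => nil
  | [_] => leaf 1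
  | [_, _] => node 1 (leaf 2) nil
  | k :: y :: z :: rest =>
      if y + 1 = k then
        insertB k ((psi ((z :: rest).map (relabelDown k))).map (relabelUp k))
      else if h : y + 1 < k then
        let t := psi ((k :: y :: z :: rest).map (Equiv.swap (k - 1) k))
        if AreSiblings (k - 1) k t then siblingMove k t
        else t.map (Equiv.swap (k - 1) k)
      else nil
termination_by σ => (σ.length, σ.headD 0)
decreasing_by
  · simp [Prod.lex_def]
  · have : k - 1 < k := by omega
    simpa [Prod.lex_def] using this

/-! ### Algorithm C: the direct map `ψ'` -/

/-- For a tree with maximal path (root, right child of the root, its right child, …)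
`v₁ < v₂ < ⋯`, let `v₁, …, v_j` be its vertices less than `x` (with `v₁ < x`), `S₁, …, S_j` their
left subtrees and `S_{j+1}` the right subtree of `v_j`.  The result is the path of left edges
`v₁, …, v_j, x` with `S₂, …, S_{j+1}` as the right subtrees of `v₁, …, v_j`; the tree `S₁` is
dropped. -/
def flipPath (x : ℕ) : BinaryTree ℕ → BinaryTree ℕ
  | nil => nil
  | node v _ nil => node v (leaf x) nil
  | node v _ (node w l r) =>
      if w < x then node v (flipPath x (node w l r)) l
      else node v (leaf x) (node w l r)

/-- What happens to the subtree `S` with root `a`, where `a` is the smallest vertex greater than `y`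
in the minimal path, when the pair `(x, y)` is read.

If `a < x`, then `y` takes the place of `a`, with the flipped path `a = v₁, …, v_j = b, x` as left
subtree and the left subtree `S₁` of `a` as right subtree.
If `x < a`, then `y` takes the place of `a`, with the leaf `x` as left and `S` as right subtree. -/
def graftPair (x y : ℕ) : BinaryTree ℕ → BinaryTree ℕ
  | nil => nil
  | node a l r =>
      if a < x then node y (flipPath x (node a l r)) l
      else node y (leaf x) (node a l r)

/-- The map `ψ'`: read the pairs `(σ₁, σ₂), (σ₃, σ₄), …` from right to left, starting from the tree
of the last pair (or of the last letter, if the length is odd). -/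
def psi' : List ℕ → BinaryTree ℕ
  | [] => nil
  | [x] => leaf x
  | [x, y] => node y (leaf x) nil
  | x :: y :: z :: rest => modifyMinPath y (graftPair x y) (psi' (z :: rest))

end Entringer

namespace Entringer

open BinaryTree

/-! ### Labels, roots and minimal leaves -/

/-! Both algorithms are compared through one recursive operation, `graft x y`, which reads a pair `y
< x` into a tree. At a vertex `v < y` it continues into the left subtree. At a vertex with `y < v <
x` it puts `y` in place of `v`, moves the old left subtree to the right, and continues on the left
by grafting `(x, v)` into the old right subtree. At a vertex `v > x` it puts `y` above `v`, with the
leaf `x` on the left. The path flip of Algorithm C is the iteration of the middle branch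
(`flipPath_eq_graft`, `modifyMinPath_graftPair`).

Algorithm C is bijective because each graft can be undone: `x` is the new minimal leaf, and the
convention that the smaller sibling is on the left reveals which branch was taken (`ungraft_graft`).
Conversely, every increasing tree whose root is not its minimal leaf is a graft (`exists_graft_eq`).
The condition `y < z` on a word `x y z …` says exactly that `y` lies below the minimal leaf of the
tree being grafted into.

The algorithms agree by induction along the recursion of `psi`. Since `graft` only compares labels,
`psi'` commutes with order-preserving relabellings, so only the last graft has to be compared. In
case (B1) the middle branch cannot occur, and `graft` is `insertB`. In case (B2) the grafts with `x
= k-1` and `x = k` diverge only on meeting the other of these two labels, which is precisely when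
siblings appear (`isExchange_graft`). -/

theorem root?_mem {t : BinaryTree ℕ} {a : ℕ} (h : root? t = some a) : a ∈ labels t := by
  cases t <;> simp_all [root?, labels]

theorem minLeaf?_node_nil (v : ℕ) (r : BinaryTree ℕ) : minLeaf? (node v nil r) = some v := by
  simp [minLeaf?, minPath]

theorem minLeaf?_node {l : BinaryTree ℕ} (h : l ≠ nil) (v : ℕ) (r : BinaryTree ℕ) :
    minLeaf? (node v l r) = minLeaf? l := by
  cases l with
  | nil => exact absurd rfl h
  | node w l' r' => simp [minLeaf?, minPath, List.getLast?_cons_cons]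

theorem minLeaf?_mem {t : BinaryTree ℕ} {a : ℕ} (h : minLeaf? t = some a) : a ∈ labels t := by
  induction t with
  | nil => simp [minLeaf?, minPath] at h
  | node v l r ihl _ =>
    by_cases hl : l = nil
    · subst hl
      rw [minLeaf?_node_nil] at h
      simp_all [labels]
    · rw [minLeaf?_node hl] at h
      simp [labels, ihl h]

theorem minLeaf?_ne_none {t : BinaryTree ℕ} (h : t ≠ nil) : ∃ a, minLeaf? t = some a := by
  induction t with
  | nil => exact absurd rfl h
  | node v l r ihl _ =>
    by_cases hl : l = nil
    · subst hl
      exact ⟨v, minLeaf?_node_nil v r⟩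
    · rw [minLeaf?_node hl]
      exact ihl hl

theorem root?_lt {v a : ℕ} {l r : BinaryTree ℕ} (h : IsIncreasing (node v l r))
    (ha : a ∈ labels (node v l r)) : v ≤ a := by
  simp only [IsIncreasing] at h
  simp only [labels, List.mem_cons, List.mem_append] at ha
  rcases ha with rfl | ha | ha
  · exact le_rfl
  · exact (h.1 a ha).le
  · exact (h.2.1 a ha).le

theorem root?_ne_none {t : BinaryTree ℕ} (h : t ≠ nil) : ∃ a, root? t = some a := by
  cases t with
  | nil => exact absurd rfl h
  | node v l r => exact ⟨v, rfl⟩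

theorem isIncreasing_leaf (x : ℕ) : IsIncreasing (leaf x) := by
  simp [leaf, IsIncreasing, labels, root?]

/-! ### The uniform description of one step of Algorithm C -/

/-- One step of Algorithm C: read the pair `(x, y)` into the tree, in a uniform recursive form. -/
def graft (x y : ℕ) : BinaryTree ℕ → BinaryTree ℕ
  | nil => node y (leaf x) nil
  | node v l r =>
      if v < y then node v (graft x y l) r
      else if v < x then node y (graft x v r) l
      else node y (leaf x) (node v l r)

/-- The conditions under which the pair `(x, y)` may be grafted into a tree. -/
structure Graftable (x y : ℕ) (t : BinaryTree ℕ) : Prop where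
  inc : IsIncreasing t
  notMem_left : x ∉ labels t
  notMem_right : y ∉ labels t
  lt : y < x
  lt_minLeaf : ∀ z, minLeaf? t = some z → y < z

/-- As `y` lies below the minimal leaf, the descent past labels smaller than `y` never leaves the
minimal path. -/
theorem Graftable.left {x y v : ℕ} {l r : BinaryTree ℕ} (h : Graftable x y (node v l r))
    (hv : v < y) : l ≠ nil ∧ Graftable x y l := by
  obtain ⟨h1, h2, h3, h4, h5⟩ := h
  have hl : l ≠ nil := by
    rintro rfl
    have := h5 v (minLeaf?_node_nil v r)
    omega
  rw [minLeaf?_node hl] at h5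
  simp only [labels, List.mem_cons, List.mem_append, not_or] at h2 h3
  exact ⟨hl, h1.2.2.2.1, h2.2.1, h3.2.1, h4, h5⟩

/-- In the middle branch `v` takes over the role of `y`; every label of `r` exceeds `v`, so the
condition on the minimal leaf is automatic. -/
theorem Graftable.right {x y v : ℕ} {l r : BinaryTree ℕ} (h : Graftable x y (node v l r))
    (hv : v < x) : Graftable x v r := by
  obtain ⟨h1, h2, h3, h4, h5⟩ := h
  simp only [labels, List.mem_cons, List.mem_append, not_or] at h2 h3
  exact ⟨h1.2.2.2.2, h2.2.2, fun hm => lt_irrefl _ (h1.2.1 _ hm), hv,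
    fun z hz => h1.2.1 z (minLeaf?_mem hz)⟩

theorem labels_graft (x y : ℕ) (t : BinaryTree ℕ) :
    (labels (graft x y t)).Perm (x :: y :: labels t) := by
  induction t generalizing y with
  | nil => simpa [graft, labels, leaf] using List.Perm.swap x y []
  | node v l r ihl ihr =>
    have h1 := fun a => (ihl y).count_eq a
    have h2 := fun a => (ihr v).count_eq a
    simp only [graft]
    split_ifs <;> rw [List.perm_iff_count] <;> intro a <;>
      simp only [labels, leaf, List.count_cons, List.count_append, List.count_nil, h1, h2] <;>
      omega

theorem mem_labels_graft {x y a : ℕ} {t : BinaryTree ℕ} :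
    a ∈ labels (graft x y t) ↔ a = x ∨ a = y ∨ a ∈ labels t := by
  simp [(labels_graft x y t).mem_iff]

theorem graft_eq_node (x y : ℕ) (t : BinaryTree ℕ) :
    ∃ v l r, graft x y t = node v l r ∧ l ≠ nil := by
  induction t generalizing y with
  | nil => exact ⟨y, leaf x, nil, rfl, by simp [leaf]⟩
  | node v l r ihl ihr =>
    obtain ⟨_, _, _, h1, -⟩ := ihl y
    obtain ⟨_, _, _, h2, -⟩ := ihr v
    simp only [graft]
    split_ifs
    · exact ⟨_, _, _, rfl, by simp [h1]⟩
    · exact ⟨_, _, _, rfl, by simp [h2]⟩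
    · exact ⟨_, _, _, rfl, by simp [leaf]⟩

theorem graft_ne_nil (x y : ℕ) (t : BinaryTree ℕ) : graft x y t ≠ nil := by
  obtain ⟨_, _, _, h, -⟩ := graft_eq_node x y t
  simp [h]

theorem root?_graft_nil (x y : ℕ) : root? (graft x y nil) = some y := rfl

theorem root?_graft_node (x y v : ℕ) (l r : BinaryTree ℕ) :
    root? (graft x y (node v l r)) = some (if v < y then v else y) := by
  simp only [graft]
  split_ifs <;> rfl

theorem minLeaf?_graft {x y : ℕ} {t : BinaryTree ℕ} : minLeaf? (graft x y t) = some x := by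
  induction t generalizing y with
  | nil => simp [graft, leaf, minLeaf?, minPath]
  | node v l r ihl ihr =>
    simp only [graft]
    split_ifs
    · rw [minLeaf?_node (graft_ne_nil _ _ _), ihl]
    · rw [minLeaf?_node (graft_ne_nil _ _ _), ihr]
    · rw [minLeaf?_node (by simp [leaf]), leaf, minLeaf?_node_nil]

theorem isIncreasing_graft {x y : ℕ} {t : BinaryTree ℕ} (h : Graftable x y t) :
    IsIncreasing (graft x y t) := by
  induction t generalizing y with
  | nil =>
    have := h.lt
    simp [graft, leaf, IsIncreasing, labels, root?, this]
  | node v l r ihl ihr =>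
    have hlt := h.lt
    have hx := h.notMem_left
    have hy := h.notMem_right
    have hinc := h.inc
    obtain ⟨i1, i2, i3, i4, i5⟩ := hinc
    simp only [labels, List.mem_cons, List.mem_append, not_or] at hx hy
    simp only [graft]
    split_ifs with h1 h2
    · obtain ⟨hl, hg⟩ := h.left h1
      refine ⟨?_, i2, ?_, ihl hg, i5⟩
      · intro a ha
        rw [mem_labels_graft] at ha
        rcases ha with rfl | rfl | ha
        · omega
        · omega
        · exact i1 a ha
      -- The left root is either unchanged or replaced by the smaller `y`, so it stays below its
      -- sibling.
      · intro b hb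
        obtain ⟨w, hw, hwb⟩ := i3 b hb
        cases l with
        | nil => exact absurd rfl hl
        | node w' l' r' =>
          rw [root?_graft_node]
          refine ⟨_, rfl, ?_⟩
          simp only [root?, Option.some.injEq] at hw
          split_ifs <;> omega
    · refine ⟨?_, ?_, ?_, ihr (h.right h2), i4⟩
      · intro a ha
        rw [mem_labels_graft] at ha
        rcases ha with rfl | rfl | ha
        · omega
        · omega
        · have := i2 a ha
          omega
      · intro a ha
        have := i1 a ha
        omega
      -- The new left child is `v`, formerly the parent of the root `b` of the new right subtree,
      -- hence smaller.
      · intro b hb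
        have hvb := i1 b (root?_mem hb)
        cases r with
        | nil => exact ⟨v, rfl, hvb⟩
        | node w l' r' =>
          rw [root?_graft_node]
          refine ⟨_, rfl, ?_⟩
          split_ifs <;> omega
    · refine ⟨by simp [leaf, labels, hlt], ?_, ?_, isIncreasing_leaf x, h.inc⟩
      · intro a ha
        have := root?_lt h.inc ha
        omega
      · intro b hb
        simp only [root?, Option.some.injEq] at hb
        exact ⟨x, rfl, by omega⟩

/-- Labels increase along the path of right children, so the branch `w < v` of `graft` never fires
there. The left subtree that `flipPath` drops at `w` is the one hung to the right of the vertex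
above. -/
theorem flipPath_eq_graft {x v : ℕ} {l r : BinaryTree ℕ} (h : IsIncreasing (node v l r)) :
    flipPath x (node v l r) = graft x v r := by
  induction r generalizing v l with
  | nil => rfl
  | node w l' r' _ ih =>
    have hvw : v < w := h.2.1 w (by simp [labels])
    simp only [flipPath, graft, if_neg hvw.not_gt]
    rw [ih h.2.2.2.2]

/-- The empty tree is excluded because `graft` starts a two-vertex tree there, while `modifyMinPath`
leaves it empty. -/
theorem modifyMinPath_graftPair {x y : ℕ} {t : BinaryTree ℕ} (h : Graftable x y t)
    (ht : t ≠ nil) : modifyMinPath y (graftPair x y) t = graft x y t := by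
  induction t with
  | nil => exact absurd rfl ht
  | node v l r ihl _ =>
    have hy : y ≠ v := fun hyv => h.notMem_right (by simp [labels, hyv])
    simp only [modifyMinPath, graft, graftPair]
    rw [flipPath_eq_graft h.inc]
    rcases lt_or_gt_of_ne hy with hv | hv
    · rw [if_pos hv, if_neg hv.not_gt]
    · obtain ⟨hl, hg⟩ := h.left hv
      rw [if_pos hv, if_neg hv.not_gt, ihl hg hl]

/-! ### Inverting one step of Algorithm C -/

/-- `rootBelow r t`: the tree `t` is empty, or `r` has a root that is smaller than the root of `t`. -/
def rootBelow : BinaryTree ℕ → BinaryTree ℕ → Bool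
  | _, nil => true
  | nil, node _ _ _ => false
  | node a _ _, node b _ _ => a < b

/-- The inverse of `graft`: recover `y` and `t` from `graft x y t`. -/
def ungraft : BinaryTree ℕ → ℕ × BinaryTree ℕ
  | nil => (0, nil)
  | node v nil r => (v, r)
  | node v (node _ nil _) r => (v, r)
  | node v (node q (node a b c) d) r =>
      let p := ungraft (node q (node a b c) d)
      if rootBelow r p.2 then (v, node p.1 r p.2) else (p.1, node v p.2 r)

theorem ungraft_leaf (x v : ℕ) (r : BinaryTree ℕ) : ungraft (node v (leaf x) r) = (v, r) := by
  simp [leaf, ungraft]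

theorem ungraft_graft_step (x y v : ℕ) (t r : BinaryTree ℕ) :
    ungraft (node v (graft x y t) r) =
      if rootBelow r (ungraft (graft x y t)).2 then
        (v, node (ungraft (graft x y t)).1 r (ungraft (graft x y t)).2)
      else ((ungraft (graft x y t)).1, node v (ungraft (graft x y t)).2 r) := by
  obtain ⟨q, l, d, h, hl⟩ := graft_eq_node x y t
  rw [h]
  cases l with
  | nil => exact absurd rfl hl
  | node a b c => rw [ungraft]

/-- Let the left subtree ungraft to a remainder `s`, and let `r` be the right subtree. After
descent, `s` is the old left sibling of `r`: nonempty, and smaller at the root if `r` is nonempty.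
After the middle branch the roles are reversed, and `rootBelow r s` detects this. The last branch
shows by its leaf. -/
theorem ungraft_graft {x y : ℕ} {t : BinaryTree ℕ} (h : Graftable x y t) :
    ungraft (graft x y t) = (y, t) := by
  induction t generalizing y with
  | nil => exact ungraft_leaf x y nil
  | node v l r ihl ihr =>
    have hinc := h.inc
    obtain ⟨i1, i2, i3, i4, i5⟩ := hinc
    simp only [graft]
    split_ifs with h1 h2
    · obtain ⟨hl, hg⟩ := h.left h1
      rw [ungraft_graft_step, ihl hg, if_neg]
      cases l with
      | nil => exact absurd rfl hl
      | node a b c =>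
        cases r with
        | nil => simp [rootBelow]
        | node a' b' c' =>
          obtain ⟨w, hw, hwa⟩ := i3 a' rfl
          simp only [root?, Option.some.injEq] at hw
          simp only [rootBelow, decide_eq_true_eq]
          omega
    · rw [ungraft_graft_step, ihr (h.right h2), if_pos]
      cases r with
      | nil => cases l <;> rfl
      | node a' b' c' =>
        obtain ⟨w, hw, hwa⟩ := i3 a' rfl
        cases l with
        | nil => simp [root?] at hw
        | node a b c =>
          simp only [root?, Option.some.injEq] at hw
          simp only [rootBelow, decide_eq_true_eq]
          omega
    · exact ungraft_leaf x y _

/-- Recursion down the minimal path: if the left child is the leaf `x`, the last branch of `graft`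
applies; otherwise the left subtree is itself a graft, and `rootBelow` decides between the other two
branches. -/
theorem exists_graft_eq {t : BinaryTree ℕ} {x : ℕ} (hinc : IsIncreasing t)
    (hnd : (labels t).Nodup) (hx : minLeaf? t = some x) (hxt : root? t ≠ some x) :
    ∃ y s, Graftable x y s ∧ graft x y s = t := by
  induction t with
  | nil => simp [minLeaf?, minPath] at hx
  | node v l r ihl _ =>
    have hl : l ≠ nil := by
      rintro rfl
      rw [minLeaf?_node_nil] at hx
      exact hxt hx
    rw [minLeaf?_node hl] at hx
    obtain ⟨i1, i2, i3, i4, i5⟩ := hinc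
    simp only [labels, List.nodup_cons, List.mem_append, not_or, List.nodup_append] at hnd
    obtain ⟨⟨hvl, hvr⟩, hndl, hndr, hdis⟩ := hnd
    have hxl : x ∈ labels l := minLeaf?_mem hx
    have hvx : v < x := i1 x hxl
    have hxr : x ∉ labels r := fun h => hdis x hxl x h rfl
    by_cases hroot : root? l = some x
    · have hlx : l = leaf x := by
        cases l with
        | nil => exact absurd rfl hl
        | node w a b =>
          obtain rfl : w = x := by simpa [root?] using hroot
          have ha : a = nil := by
            by_contra ha
            rw [minLeaf?_node ha] at hx
            exact lt_irrefl _ (i4.1 w (minLeaf?_mem hx))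
          have hb : b = nil := by
            by_contra hb
            obtain ⟨c, hc⟩ := root?_ne_none hb
            obtain ⟨d, hd, -⟩ := i4.2.2.1 c hc
            rw [ha] at hd
            simp [root?] at hd
          rw [ha, hb, leaf]
      refine ⟨v, r, ⟨i5, hxr, hvr, hvx, fun z hz => i2 z (minLeaf?_mem hz)⟩, ?_⟩
      cases r with
      | nil => rw [hlx, graft]
      | node w a b =>
        obtain ⟨c, hc, hcw⟩ := i3 w rfl
        rw [hroot, Option.some.injEq] at hc
        have : v < w := i2 w (by simp [labels])
        rw [graft, if_neg (by omega), if_neg (by omega), hlx]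
    · obtain ⟨y, s, hg, rfl⟩ := ihl i4 hndl hx hroot
      have hyl : y ∈ labels (graft x y s) := mem_labels_graft.2 (Or.inr (Or.inl rfl))
      have hsl : ∀ a ∈ labels s, a ∈ labels (graft x y s) :=
        fun a ha => mem_labels_graft.2 (Or.inr (Or.inr ha))
      have hvy : v < y := i1 y hyl
      have hyr : y ∉ labels r := fun h => hdis y hyl y h rfl
      by_cases hrb : rootBelow r s
      -- If the root `b` of `s` were below `y`, it would be the root of the graft and so smaller
      -- than the root `a` of `r`, against `rootBelow`.
      · have hys : ∀ a ∈ labels s, y < a := by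
          cases s with
          | nil => simp [labels]
          | node b l' r' =>
            cases r with
            | nil => simp [rootBelow] at hrb
            | node a l'' r'' =>
              obtain ⟨c, hc, hca⟩ := i3 a rfl
              rw [root?_graft_node, Option.some.injEq] at hc
              simp only [rootBelow, decide_eq_true_eq] at hrb
              intro z hz
              have := root?_lt hg.inc hz
              have hbz : b ∈ labels (node b l' r') := by simp [labels]
              have : b ≠ y := fun hby => hg.notMem_right (hby ▸ hbz)
              split_ifs at hc <;> omega
        have hyr' : ∀ a ∈ labels r, y < a := by
          intro z hz
          cases r with
          | nil => simp [labels] at hz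
          | node a l'' r'' =>
            have := root?_lt i5 hz
            obtain ⟨c, hc, hca⟩ := i3 a rfl
            cases s with
            | nil =>
              simp only [graft, root?, Option.some.injEq] at hc
              omega
            | node b l' r' =>
              rw [root?_graft_node, Option.some.injEq] at hc
              have := hys b (by simp [labels])
              rw [if_neg (by omega)] at hc
              omega
        have hvs : v ∉ labels s := fun h => hvl (hsl v h)
        refine ⟨v, node y r s, ⟨⟨hyr', hys, ?_, i5, hg.inc⟩, ?_, ?_, hvx, ?_⟩, ?_⟩
        · intro b hb
          cases s with
          | nil => simp [root?] at hb
          | node b' l' r' =>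
            cases r with
            | nil => simp [rootBelow] at hrb
            | node a l'' r'' =>
              simp only [rootBelow, decide_eq_true_eq] at hrb
              simp only [root?, Option.some.injEq] at hb
              exact ⟨a, rfl, by omega⟩
        · have := hg.lt
          simp only [labels, List.mem_cons, List.mem_append, not_or]
          exact ⟨by omega, hxr, hg.notMem_left⟩
        · simp only [labels, List.mem_cons, List.mem_append, not_or]
          exact ⟨by omega, hvr, hvs⟩
        · intro z hz
          have hz' := minLeaf?_mem hz
          simp only [labels, List.mem_cons, List.mem_append] at hz'
          rcases hz' with rfl | hz' | hz'
          · exact hvy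
          · exact i2 z hz'
          · exact i1 z (hsl z hz')
        · rw [graft, if_neg (by omega), if_pos hg.lt]
      · cases s with
        | nil => cases r <;> simp [rootBelow] at hrb
        | node b l' r' =>
          refine ⟨y, node v (node b l' r') r, ⟨⟨fun a ha => i1 a (hsl a ha), i2, ?_, hg.inc, i5⟩,
            ?_, ?_, hg.lt, ?_⟩, ?_⟩
          · intro a ha
            cases r with
            | nil => simp [root?] at ha
            | node a' l'' r'' =>
              simp only [root?, Option.some.injEq] at ha
              simp only [rootBelow, decide_eq_true_eq] at hrb
              have hne := hdis b (hsl b (by simp [labels])) a' (by simp [labels])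
              exact ⟨b, rfl, by omega⟩
          · simp only [labels.eq_2 v, List.mem_cons, List.mem_append, not_or]
            exact ⟨by omega, hg.notMem_left, hxr⟩
          · simp only [labels.eq_2 v, List.mem_cons, List.mem_append, not_or]
            exact ⟨by omega, hg.notMem_right, hyr⟩
          · rw [minLeaf?_node (by simp)]
            exact hg.lt_minLeaf
          · rw [graft, if_pos hvy]

/-! ### Alternating words -/

theorem isDownUp_pair {x y : ℕ} : IsDownUp [x, y] ↔ y < x := by
  constructor
  · intro h
    simpa using (h 0 (by simp)).1
  · intro h i hi
    obtain rfl : i = 0 := by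
      simp at hi
      omega
    simp [h]

theorem isDownUp_cons_cons_cons {x y z : ℕ} {σ : List ℕ} :
    IsDownUp (x :: y :: z :: σ) ↔ y < x ∧ y < z ∧ IsDownUp (z :: σ) := by
  constructor
  · intro h
    refine ⟨by simpa using (h 0 (by simp)).1, (h 1 (by simp)).2 odd_one, ?_⟩
    intro i hi
    have := h (i + 2) (by simpa using hi)
    simpa [Nat.even_add, Nat.odd_add] using this
  · rintro ⟨h1, h2, h3⟩ i hi
    match i with
    | 0 => simpa using h1
    | 1 => simpa using h2
    | i + 2 =>
      have := h3 i (by simpa using hi)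
      simpa [Nat.even_add, Nat.odd_add] using this

theorem IsDownUp.map {f : ℕ → ℕ} {σ : List ℕ} (h : IsDownUp σ)
    (hf : StrictMonoOn f {a | a ∈ σ}) : IsDownUp (σ.map f) := by
  intro i hi
  simp only [List.length_map] at hi
  simp only [List.getElem_map]
  exact ⟨fun he => hf (List.getElem_mem _) (List.getElem_mem _) ((h i hi).1 he),
    fun ho => hf (List.getElem_mem _) (List.getElem_mem _) ((h i hi).2 ho)⟩

/-! ### Algorithm C is a bijection -/

/-- The clauses are proved together: the minimal leaf of the tail's tree is the letter `z`, so `y <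
z` gives the graftability required for the next step. -/
theorem psi'_spec {σ : List ℕ} (hnd : σ.Nodup) (h : IsDownUp σ) :
    IsIncreasing (psi' σ) ∧ (labels (psi' σ)).Perm σ ∧ minLeaf? (psi' σ) = σ.head? ∧
      ∀ x y z τ, σ = x :: y :: z :: τ →
        Graftable x y (psi' (z :: τ)) ∧ psi' σ = graft x y (psi' (z :: τ)) := by
  induction σ using psi'.induct with
  | case1 => simp [psi', IsIncreasing, labels, minLeaf?, minPath]
  | case2 x =>
    refine ⟨isIncreasing_leaf x, ?_⟩
    simp [psi', labels, leaf, minLeaf?, minPath]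
  | case3 x y =>
    have hyx := isDownUp_pair.1 h
    simp [psi', leaf, IsIncreasing, labels, root?, minLeaf?, minPath, hyx, List.Perm.swap]
  | case4 x y z τ ih =>
    obtain ⟨hyx, hyz, h'⟩ := isDownUp_cons_cons_cons.1 h
    obtain ⟨hx, hy, hnd'⟩ : x ∉ y :: z :: τ ∧ y ∉ z :: τ ∧ (z :: τ).Nodup := by
      rw [List.nodup_cons, List.nodup_cons] at hnd
      exact hnd
    obtain ⟨ih1, ih2, ih3, -⟩ := ih hnd' h'
    have hg : Graftable x y (psi' (z :: τ)) := by
      refine ⟨ih1, ?_, ?_, hyx, ?_⟩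
      · rw [ih2.mem_iff]
        exact fun hm => hx (List.mem_cons_of_mem _ hm)
      · rwa [ih2.mem_iff]
      · intro w hw
        rw [ih3] at hw
        simp only [List.head?_cons, Option.some.injEq] at hw
        omega
    have hne : psi' (z :: τ) ≠ nil := by
      intro hnil
      rw [hnil] at ih3
      simp [minLeaf?, minPath] at ih3
    have heq : psi' (x :: y :: z :: τ) = graft x y (psi' (z :: τ)) := by
      rw [psi', modifyMinPath_graftPair hg hne]
    refine ⟨heq ▸ isIncreasing_graft hg, ?_, by rw [heq, minLeaf?_graft, List.head?_cons], ?_⟩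
    · rw [heq]
      exact (labels_graft _ _ _).trans ((ih2.cons y).cons x)
    · rintro x' y' z' τ' hσ
      simp only [List.cons.injEq] at hσ
      obtain ⟨rfl, rfl, rfl, rfl⟩ := hσ
      exact ⟨hg, heq⟩

/-- The first letter is the minimal leaf, and `ungraft` returns the second letter and the tree of
the tail. Arbitrary distinct letters are allowed so that the induction can pass to the tail. -/
theorem psi'_injective {σ τ : List ℕ} (hσ : σ.Nodup) (hσ' : IsDownUp σ) (hτ : τ.Nodup)
    (hτ' : IsDownUp τ) (h : psi' σ = psi' τ) : σ = τ := by
  induction σ using psi'.induct generalizing τ with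
  | case1 =>
    have := (psi'_spec hτ hτ').2.1.length_eq
    rw [← h] at this
    exact (List.length_eq_zero_iff.1 this.symm).symm
  | case2 x =>
    have h1 := (psi'_spec hτ hτ').2.1
    rw [← h] at h1
    exact (List.perm_singleton.1 h1.symm).symm
  | case3 x y =>
    have h1 := (psi'_spec hτ hτ').2.1
    have h2 := (psi'_spec hτ hτ').2.2.1
    rw [← h] at h1 h2
    have h3 := h1.length_eq
    simp only [psi', leaf, labels, minLeaf?, minPath, List.length_cons] at h1 h2 h3
    match τ with
    | [a, b] =>
      obtain rfl : x = a := by simpa using h2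
      have hb : b ∈ [y, x] := by simpa using h1.mem_iff.2 (show b ∈ [x, b] by simp)
      have hbx : b ≠ x := by
        rintro rfl
        simp at hτ
      have : b = y := by simpa [hbx] using hb
      rw [this]
    | [] => simp at h3
    | [_] => simp at h3
    | _ :: _ :: _ :: _ => simp at h3
  | case4 x y z σ ih =>
    obtain ⟨-, h1, h2, h3⟩ := psi'_spec hσ hσ'
    obtain ⟨-, h1', h2', h3'⟩ := psi'_spec hτ hτ'
    have hlen := h1.length_eq.symm.trans (by rw [h, h1'.length_eq])
    match τ with
    | [] => simp at hlen
    | [_] => simp at hlen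
    | [_, _] => simp at hlen
    | a :: b :: c :: τ =>
      obtain ⟨hg, he⟩ := h3 _ _ _ _ rfl
      obtain ⟨hg', he'⟩ := h3' _ _ _ _ rfl
      have hp : (y, psi' (z :: σ)) = (b, psi' (c :: τ)) := by
        rw [← ungraft_graft hg, ← ungraft_graft hg', ← he, ← he', h]
      obtain rfl : x = a := by
        rw [h, h2'] at h2
        simpa using h2.symm
      simp only [Prod.mk.injEq] at hp
      rw [hp.1, ih hσ.of_cons.of_cons (isDownUp_cons_cons_cons.1 hσ').2.2 hτ.of_cons.of_cons
        (isDownUp_cons_cons_cons.1 hτ').2.2 hp.2]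

theorem psi'_surjective {t : BinaryTree ℕ} (hinc : IsIncreasing t) (hnd : (labels t).Nodup) :
    ∃ σ : List ℕ, σ.Nodup ∧ IsDownUp σ ∧ psi' σ = t := by
  induction hn : (labels t).length using Nat.strong_induction_on generalizing t with
  | _ n ih =>
    by_cases ht : t = nil
    · subst ht
      exact ⟨[], List.nodup_nil, fun i hi => absurd hi (by simp), rfl⟩
    · obtain ⟨x, hx⟩ := minLeaf?_ne_none ht
      by_cases hr : root? t = some x
      · obtain ⟨l, r, rfl⟩ : ∃ l r, t = node x l r := by
          cases t with
          | nil => exact absurd rfl ht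
          | node v l r =>
            simp only [root?, Option.some.injEq] at hr
            exact ⟨l, r, by rw [hr]⟩
        have hl : l = nil := by
          by_contra hl
          rw [minLeaf?_node hl] at hx
          exact lt_irrefl _ (hinc.1 x (minLeaf?_mem hx))
        have hr : r = nil := by
          by_contra hr
          obtain ⟨c, hc⟩ := root?_ne_none hr
          obtain ⟨d, hd, -⟩ := hinc.2.2.1 c hc
          rw [hl] at hd
          simp [root?] at hd
        refine ⟨[x], by simp, fun i hi => absurd hi (by simp), ?_⟩
        rw [hl, hr, psi', leaf]
      · obtain ⟨y, s, hg, rfl⟩ := exists_graft_eq hinc hnd hx hr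
        have hp := labels_graft x y s
        have hnd' := hp.nodup_iff.1 hnd
        have hlen := hp.length_eq
        simp only [List.length_cons] at hlen
        obtain ⟨σ, hσ, hσ', rfl⟩ := ih _ (by omega) hg.inc hnd'.of_cons.of_cons rfl
        obtain ⟨-, h1, h2, h3⟩ := psi'_spec hσ hσ'
        have hnd'' := (((h1.cons y).cons x).nodup_iff).1 hnd'
        cases σ with
        | nil => exact ⟨[x, y], hnd'', isDownUp_pair.2 hg.lt, rfl⟩
        | cons z σ =>
          have hd := isDownUp_cons_cons_cons.2 ⟨hg.lt, hg.lt_minLeaf z h2, hσ'⟩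
          exact ⟨x :: y :: z :: σ, hnd'', hd, ((psi'_spec hnd'' hd).2.2.2 _ _ _ _ rfl).2⟩

theorem bijOn_psi' (n k : ℕ) : Set.BijOn psi' (DUFirst n k) (TreesLeaf n k) := by
  have hnd : ∀ {σ : List ℕ}, σ.Perm (List.range' 1 n) → σ.Nodup :=
    fun h => h.nodup_iff.2 List.nodup_range'
  refine ⟨?_, ?_, ?_⟩
  · rintro σ ⟨⟨hp, hd⟩, hk⟩
    obtain ⟨h1, h2, h3, -⟩ := psi'_spec (hnd hp) hd
    exact ⟨⟨h2.trans hp, h1⟩, h3.trans hk⟩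
  · rintro σ ⟨⟨hp, hd⟩, -⟩ τ ⟨⟨hp', hd'⟩, -⟩ h
    exact psi'_injective (hnd hp) hd (hnd hp') hd' h
  · rintro t ⟨⟨hp, hinc⟩, hk⟩
    obtain ⟨σ, hσ, hd, rfl⟩ := psi'_surjective hinc (hnd hp)
    obtain ⟨-, h2, h3, -⟩ := psi'_spec hσ hd
    exact ⟨σ, ⟨⟨h2.symm.trans hp, hd⟩, h3.symm.trans hk⟩, rfl⟩

/-! ### Relabelling -/

theorem labels_map (f : ℕ → ℕ) (t : BinaryTree ℕ) : labels (t.map f) = (labels t).map f := by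
  induction t with
  | nil => rfl
  | node v l r ihl ihr => simp [BinaryTree.map, labels, ihl, ihr]

theorem map_eq_self {f : ℕ → ℕ} {t : BinaryTree ℕ} (h : ∀ a ∈ labels t, f a = a) :
    t.map f = t := by
  induction t with
  | nil => rfl
  | node v l r ihl ihr =>
    simp only [labels, List.mem_cons, List.mem_append, forall_eq_or_imp] at h
    rw [BinaryTree.map, h.1, ihl fun a ha => h.2 a (Or.inl ha), ihr fun a ha => h.2 a (Or.inr ha)]

theorem map_swap_map_swap (a b : ℕ) (t : BinaryTree ℕ) :
    (t.map (Equiv.swap a b)).map (Equiv.swap a b) = t := by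
  rw [← BinaryTree.comp_map]
  exact map_eq_self fun c _ => by simp

theorem graft_map {f : ℕ → ℕ} {S : Set ℕ} (hf : StrictMonoOn f S) {x y : ℕ} {t : BinaryTree ℕ}
    (hx : x ∈ S) (hy : y ∈ S) (ht : ∀ a ∈ labels t, a ∈ S) :
    graft (f x) (f y) (t.map f) = (graft x y t).map f := by
  induction t generalizing y with
  | nil => rfl
  | node v l r ihl ihr =>
    simp only [labels, List.mem_cons, List.mem_append, forall_eq_or_imp] at ht
    obtain ⟨hv, ht⟩ := ht
    simp only [BinaryTree.map, graft, hf.lt_iff_lt hv hy, hf.lt_iff_lt hv hx,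
      ihl hy fun a ha => ht a (Or.inl ha), ihr hv fun a ha => ht a (Or.inr ha)]
    split_ifs <;> rfl

theorem psi'_map {f : ℕ → ℕ} {σ : List ℕ} (hf : StrictMonoOn f {a | a ∈ σ}) (hnd : σ.Nodup)
    (h : IsDownUp σ) : psi' (σ.map f) = (psi' σ).map f := by
  induction σ using psi'.induct with
  | case1 => rfl
  | case2 x => rfl
  | case3 x y => rfl
  | case4 x y z σ ih =>
    have hnd' : ((x :: y :: z :: σ).map f).Nodup := (List.nodup_map_iff_inj_on hnd).2
      fun a ha b hb hab => hf.injOn ha hb hab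
    have e := ((psi'_spec hnd h).2.2.2 _ _ _ _ rfl).2
    have e' := ((psi'_spec hnd' (h.map hf)).2.2.2 _ _ _ _ rfl).2
    have hz := isDownUp_cons_cons_cons.1 h
    have hp := (psi'_spec hnd.of_cons.of_cons hz.2.2).2.1
    rw [e, e', ← List.map_cons, ih (hf.mono fun a ha => by simp_all) hnd.of_cons.of_cons hz.2.2]
    refine graft_map hf (by simp) (by simp) fun a ha => ?_
    have := hp.mem_iff.1 ha
    simp_all

/-! ### The first case of Algorithm B -/

/-- No label other than `k - 1` satisfies `k - 1 ≤ v < k`, so the middle branch never occurs. -/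
theorem insertB_eq_graft {k : ℕ} {t : BinaryTree ℕ} (h : Graftable k (k - 1) t) (ht : t ≠ nil) :
    insertB k t = graft k (k - 1) t := by
  rw [insertB]
  induction t with
  | nil => exact absurd rfl ht
  | node v l r ihl _ =>
    have h1 : k ≠ v := fun e => h.notMem_left (by simp [labels, e])
    have h2 : k - 1 ≠ v := fun e => h.notMem_right (by simp [labels, e])
    simp only [modifyMinPath, graft]
    by_cases hv : v < k - 1
    · obtain ⟨hl, hg⟩ := h.left hv
      rw [if_neg (by omega), if_pos hv, ihl hg hl]
    · rw [if_pos (by omega), if_neg hv, if_neg (by omega)]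

theorem strictMonoOn_relabelDown {k : ℕ} (hk : 1 ≤ k) :
    StrictMonoOn (relabelDown k) {a | a ≠ k - 1 ∧ a ≠ k} := by
  rintro a ⟨ha, ha'⟩ b ⟨hb, hb'⟩ hab
  simp only [relabelDown]
  split_ifs <;> omega

theorem relabelUp_relabelDown {k a : ℕ} (h : a ≠ k - 1) (h' : a ≠ k) (hk : 2 ≤ k) :
    relabelUp k (relabelDown k a) = a := by
  simp only [relabelUp, relabelDown]
  split_ifs <;> omega

/-! ### The second case of Algorithm B -/

theorem AreSiblings.mem {x y : ℕ} {t : BinaryTree ℕ} (h : AreSiblings x y t) :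
    x ∈ labels t ∧ y ∈ labels t := by
  induction t with
  | nil => exact h.elim
  | node v l r ihl ihr =>
    simp only [labels, List.mem_cons, List.mem_append]
    rcases h with ⟨h1, h2⟩ | h | h
    · exact ⟨Or.inr (Or.inl (root?_mem h1)), Or.inr (Or.inr (root?_mem h2))⟩
    · exact ⟨Or.inr (Or.inl (ihl h).1), Or.inr (Or.inl (ihl h).2)⟩
    · exact ⟨Or.inr (Or.inr (ihr h).1), Or.inr (Or.inr (ihr h).2)⟩

theorem siblingMove_of_not_areSiblings {k : ℕ} {t : BinaryTree ℕ} (h : ¬AreSiblings (k - 1) k t) :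
    siblingMove k t = t := by
  induction t with
  | nil => rfl
  | node v l r ihl ihr =>
    simp only [AreSiblings, not_or] at h
    rw [siblingMove, if_neg h.1, ihl h.2.1, ihr h.2.2]

/-- `t` is obtained from `u` by the second case of Algorithm B, with `k = j + 1`. -/
def IsExchange (j : ℕ) (u t : BinaryTree ℕ) : Prop :=
  (AreSiblings j (j + 1) u ∧ t = siblingMove (j + 1) u) ∨
    (¬AreSiblings j (j + 1) u ∧ t = u.map (Equiv.swap j (j + 1)))

theorem IsExchange.eq_ite {j : ℕ} {u t : BinaryTree ℕ} (h : IsExchange j u t) :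
    t = if AreSiblings j (j + 1) u then siblingMove (j + 1) u
      else u.map (Equiv.swap j (j + 1)) := by
  rcases h with ⟨h, rfl⟩ | ⟨h, rfl⟩
  · rw [if_pos h]
  · rw [if_neg h]

/-- Carries the exchange past one vertex. Both recursive branches of `graft` put the new graft in
the left subtree, so this one form serves both. The hypotheses keep the sibling pair out of the new
root and out of `s`. -/
theorem IsExchange.node {j v : ℕ} {u t s : BinaryTree ℕ} (h : IsExchange j u t) (hv : v < j)
    (hu : root? u ≠ some j) (hs : j + 1 ∉ labels s) (hus : j + 1 ∈ labels u → j ∉ labels s) :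
    IsExchange j (node v u (s.map (Equiv.swap j (j + 1)))) (node v t s) := by
  have hsw : ¬AreSiblings j (j + 1) (s.map (Equiv.swap j (j + 1))) := by
    intro h
    have := h.mem.1
    rw [labels_map, List.mem_map] at this
    obtain ⟨a, ha, hfa⟩ := this
    rw [Equiv.swap_apply_eq_iff, Equiv.swap_apply_left] at hfa
    exact hs (hfa ▸ ha)
  have hfv : Equiv.swap j (j + 1) v = v :=
    Equiv.swap_apply_of_ne_of_ne (by omega) (by omega)
  rcases h with ⟨h, rfl⟩ | ⟨h, rfl⟩
  · left
    refine ⟨Or.inr (Or.inl h), ?_⟩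
    have hself : s.map (Equiv.swap j (j + 1)) = s := by
      refine map_eq_self fun a ha => Equiv.swap_apply_of_ne_of_ne ?_ ?_
      · rintro rfl
        exact hus h.mem.2 ha
      · rintro rfl
        exact hs ha
    rw [hself] at hsw ⊢
    rw [siblingMove, if_neg fun hc => hu hc.1, siblingMove_of_not_areSiblings (k := j + 1) hsw]
  · right
    refine ⟨?_, by rw [BinaryTree.map, hfv, map_swap_map_swap]⟩
    rintro (⟨h1, -⟩ | h1 | h1)
    · exact hu h1
    · exact h h1
    · exact hsw h1

theorem root?_graft_ne {x y j : ℕ} (t : BinaryTree ℕ) (hy : y < j) :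
    root? (graft x y t) ≠ some j := by
  cases t with
  | nil =>
    rw [root?_graft_nil, Ne, Option.some.injEq]
    omega
  | node v l r =>
    rw [root?_graft_node, Ne, Option.some.injEq]
    split_ifs <;> omega

theorem succ_mem_labels_graft {j y : ℕ} {t : BinaryTree ℕ} (hy : y < j)
    (h : j + 1 ∈ labels (graft j y (t.map (Equiv.swap j (j + 1))))) : j ∈ labels t := by
  rw [mem_labels_graft, labels_map, List.mem_map] at h
  obtain h | h | ⟨a, ha, hfa⟩ := h
  · omega
  · omega
  · rw [Equiv.swap_apply_eq_iff, Equiv.swap_apply_right] at hfa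
    exact hfa ▸ ha

/-- At a root `v < j` both grafts take the same branch. At `v = j` the swapped tree shows `j + 1`,
so grafting `j` stops and creates the siblings `j`, `j + 1`, while grafting `j + 1` makes one flip.
At `v > j` both stop, and only the new leaf differs. -/
theorem isExchange_graft {j y : ℕ} {t : BinaryTree ℕ} (hinc : IsIncreasing t)
    (hnd : (labels t).Nodup) (hj : j + 1 ∉ labels t) (hy : y < j) :
    IsExchange j (graft j y (t.map (Equiv.swap j (j + 1)))) (graft (j + 1) y t) := by
  have hfix : ∀ {a}, a ≠ j → a ≠ j + 1 → Equiv.swap j (j + 1) a = a :=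
    fun h h' => Equiv.swap_apply_of_ne_of_ne h h'
  have hfy : Equiv.swap j (j + 1) y = y := hfix (by omega) (by omega)
  induction t generalizing y with
  | nil =>
    right
    simp [BinaryTree.map, graft, leaf, AreSiblings, root?, hfy]
  | node v l r ihl ihr =>
    have hinc' := hinc
    obtain ⟨i1, i2, i3, i4, i5⟩ := hinc'
    have hj' := hj
    have hnd' := hnd
    simp only [labels, List.mem_cons, List.mem_append, not_or] at hj'
    simp only [labels, List.nodup_cons, List.mem_append, not_or, List.nodup_append] at hnd'
    obtain ⟨hjv, hjl, hjr⟩ := hj'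
    obtain ⟨⟨hvl, hvr⟩, hndl, hndr, hdis⟩ := hnd'
    rcases lt_trichotomy v j with hv | rfl | hv
    · have hfv : Equiv.swap j (j + 1) v = v := hfix (by omega) (by omega)
      simp only [BinaryTree.map, graft, hfv, if_pos hv, if_pos (show v < j + 1 by omega)]
      split_ifs with h1
      · exact (ihl i4 hndl hjl hy hfy).node hv (root?_graft_ne _ hy) hjr
          fun h h' => hdis j (succ_mem_labels_graft hy h) j h' rfl
      · exact (ihr i5 hndr hjr hv hfv).node hy (root?_graft_ne _ hv) hjl
          fun h h' => hdis j h' j (succ_mem_labels_graft hv h) rfl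
    · left
      have hl : l.map (Equiv.swap v (v + 1)) = l := map_eq_self fun a ha =>
        hfix (fun h => hvl (h ▸ ha)) (fun h => hjl (h ▸ ha))
      have hr : r.map (Equiv.swap v (v + 1)) = r := map_eq_self fun a ha =>
        hfix (fun h => hvr (h ▸ ha)) (fun h => hjr (h ▸ ha))
      have hgr : graft (v + 1) v r = node v (leaf (v + 1)) r := by
        cases r with
        | nil => rfl
        | node w a b =>
          have h1 := i2 w (by simp [labels])
          have h2 : v + 1 ≠ w := fun h => hjr (by simp [labels, h])
          rw [graft, if_neg (by omega), if_neg (by omega)]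
      simp only [BinaryTree.map, Equiv.swap_apply_left, hl, hr, graft]
      rw [if_neg (by omega), if_neg (by omega), if_neg (by omega), if_pos (by omega), hgr]
      exact ⟨Or.inl ⟨rfl, rfl⟩, by simp [siblingMove, leaf, root?, BinaryTree.right, BinaryTree.left]⟩
    · right
      have hlt : ∀ a ∈ labels (node v l r), j + 1 < a := fun a ha => by
        have := root?_lt hinc ha
        omega
      have hself : (node v l r).map (Equiv.swap j (j + 1)) = node v l r := map_eq_self fun a ha =>
        hfix (by have := hlt a ha; omega) (by have := hlt a ha; omega)
      rw [hself, graft, graft, if_neg (by omega), if_neg (by omega), if_neg (by omega),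
        if_neg (by omega)]
      refine ⟨?_, ?_⟩
      · rintro (⟨-, h⟩ | h | h)
        · simp only [root?, Option.some.injEq] at h
          omega
        · simp [leaf, AreSiblings, root?] at h
        · exact hj h.mem.2
      · rw [BinaryTree.map, hself, hfy]
        simp [leaf, BinaryTree.map]

/-! ### The two algorithms agree -/

/-- Swapping adjacent values preserves order where only one of them can occur, as in the tail of a
word starting with `k = j + 1`. -/
theorem strictMonoOn_swap (j : ℕ) : StrictMonoOn (Equiv.swap j (j + 1)) {a | a ≠ j + 1} := by
  intro a ha b hb hab
  simp only [Set.mem_ofPred_eq] at ha hb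
  simp only [Equiv.swap_apply_def]
  split_ifs <;> omega

/-- The bounds on the letters are needed because `psi` writes the fixed labels `1` and `2` on words
of length one and two. -/
theorem psi_eq_psi' {σ : List ℕ} (hnd : σ.Nodup) (hr : ∀ a ∈ σ, 1 ≤ a ∧ a ≤ σ.length)
    (h : IsDownUp σ) : psi σ = psi' σ := by
  induction σ using psi.induct with
  | case1 => simp [psi, psi']
  | case2 x =>
    have := hr x (by simp)
    simp only [List.length_singleton] at this
    rw [psi, psi', show x = 1 by omega]
  | case3 x y =>
    have h1 := hr x (by simp)
    have h2 := hr y (by simp)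
    have h3 := isDownUp_pair.1 h
    simp only [List.length_cons, List.length_nil] at h1 h2
    rw [psi, psi', show x = 2 by omega, show y = 1 by omega]
  | case4 y z σ ih =>
    obtain ⟨k, hk⟩ : ∃ k, y + 1 = k := ⟨_, rfl⟩
    rw [hk] at hnd hr h ih ⊢
    obtain ⟨hyk, hyz, h'⟩ := isDownUp_cons_cons_cons.1 h
    have hnd' := hnd.of_cons.of_cons
    obtain ⟨hg, he⟩ := (psi'_spec hnd h).2.2.2 _ _ _ _ rfl
    have hp := (psi'_spec hnd' h').2.1
    have hkσ : ∀ a ∈ z :: σ, a ≠ k - 1 ∧ a ≠ k := by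
      intro a ha
      rw [← hp.mem_iff] at ha
      refine ⟨?_, fun e => hg.notMem_left (e ▸ ha)⟩
      rintro rfl
      exact hg.notMem_right (by rwa [show y = k - 1 by omega])
    have hmono : StrictMonoOn (relabelDown k) {a | a ∈ z :: σ} :=
      (strictMonoOn_relabelDown (by omega)).mono hkσ
    have hy1 := (hr y (by simp)).1
    have hkn := (hr k (by simp)).2
    simp only [List.length_cons] at hkn
    have hi := ih ((List.nodup_map_iff_inj_on hnd').2 fun a ha b hb hab => hmono.injOn ha hb hab)
      (by
        intro b hb
        obtain ⟨a, ha, rfl⟩ := List.mem_map.1 hb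
        have h1 := hr a (by simp only [List.mem_cons] at ha ⊢; tauto)
        have h2 := hkσ a ha
        simp only [List.length_cons, List.length_map] at h1 ⊢
        simp only [relabelDown]
        split_ifs <;> omega) (h'.map hmono)
    -- `psi'` commutes with `relabelDown`, which `relabelUp` then undoes, leaving the tree of the
    -- tail.
    rw [psi, if_pos hk, hi, psi'_map hmono hnd' h', ← BinaryTree.comp_map, map_eq_self, he]
    · obtain rfl : y = k - 1 := by omega
      refine insertB_eq_graft hg fun hnil => ?_
      rw [hnil] at hp
      exact List.cons_ne_nil _ _ (List.nil_perm.1 hp)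
    · intro a ha
      have := hkσ a (hp.mem_iff.1 ha)
      exact relabelUp_relabelDown this.1 this.2 (by omega)
  | case5 k y z σ hk hlt _ _ ih
  | case6 k y z σ hk hlt _ _ ih =>
    obtain ⟨j, rfl⟩ : ∃ j, k = j + 1 := ⟨k - 1, by omega⟩
    simp only [Nat.add_sub_cancel] at ih
    obtain ⟨hyk, hyz, h'⟩ := isDownUp_cons_cons_cons.1 h
    have hnd' := hnd.of_cons.of_cons
    obtain ⟨hg, he⟩ := (psi'_spec hnd h).2.2.2 _ _ _ _ rfl
    obtain ⟨q1, hp, -, -⟩ := psi'_spec hnd' h'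
    have hj : j + 1 ∉ z :: σ := by
      rw [← hp.mem_iff]
      exact hg.notMem_left
    have hmono : StrictMonoOn (Equiv.swap j (j + 1)) {a | a ∈ z :: σ} :=
      (strictMonoOn_swap j).mono fun a ha e => hj (e ▸ ha)
    have hfy : Equiv.swap j (j + 1) y = y := Equiv.swap_apply_of_ne_of_ne (by omega) (by omega)
    have hnds : (((j + 1) :: y :: z :: σ).map (Equiv.swap j (j + 1))).Nodup :=
      hnd.map (Equiv.injective _)
    have hds : IsDownUp (((j + 1) :: y :: z :: σ).map (Equiv.swap j (j + 1))) := by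
      have h2 := h'.map hmono
      simp only [List.map_cons, hfy, Equiv.swap_apply_right] at h2 ⊢
      refine isDownUp_cons_cons_cons.2 ⟨by omega, ?_, h2⟩
      rw [Equiv.swap_apply_def]
      split_ifs <;> omega
    have hjn := (hr (j + 1) (by simp)).2
    have hy1 := (hr y (by simp)).1
    have hi := ih hnds (by
      intro b hb
      obtain ⟨a, ha, rfl⟩ := List.mem_map.1 hb
      have h1 := hr a ha
      rw [List.length_map, Equiv.swap_apply_def]
      split_ifs <;> omega) hds
    obtain ⟨-, he'⟩ := (psi'_spec hnds hds).2.2.2 _ _ _ _ rfl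
    rw [Equiv.swap_apply_right, hfy, ← List.map_cons, psi'_map hmono hnd' h'] at he'
    rw [psi, if_neg hk, dif_pos hlt]
    simp only [Nat.add_sub_cancel]
    rw [hi, he', he]
    -- Subcases (a) and (b) are settled together: `IsExchange` is exactly the case distinction of
    -- (B2).
    exact ((isExchange_graft q1 (hp.nodup_iff.2 hnd') hg.notMem_left (by omega)).eq_ite).symm
  | case7 k y z σ h1 h2 =>
    have := (isDownUp_cons_cons_cons.1 h).1
    omega

end Entringer

theorem mainTheorem6 (n k : ℕ) :
    Set.BijOn Entringer.psi (Entringer.DUFirst n k) (Entringer.TreesLeaf n k) ∧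
    Set.BijOn Entringer.psi' (Entringer.DUFirst n k) (Entringer.TreesLeaf n k) ∧
    ∀ σ ∈ Entringer.DUFirst n k, Entringer.psi σ = Entringer.psi' σ := by
  have heq : ∀ σ ∈ Entringer.DUFirst n k, Entringer.psi σ = Entringer.psi' σ := by
    rintro σ ⟨⟨hp, hd⟩, -⟩
    refine Entringer.psi_eq_psi' (hp.nodup_iff.2 List.nodup_range') (fun a ha => ?_) hd
    have hlen := hp.length_eq
    have hmem := hp.mem_iff.1 ha
    simp only [List.length_range', List.mem_range'_1] at hlen hmem
    omega
  exact ⟨(Entringer.bijOn_psi' n k).congr fun σ hσ => (heq σ hσ).symm,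
    Entringer.bijOn_psi' n k, heq⟩
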